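/- Consider the coordinator model with two sites, Alice and Bob, and a coordinator without input. In each round the coordinator either stops and announces an output, or sends a message to some of the sites, each of which sends a response back; messages are non-empty bit strings. The coordinator acts on everything it has exchanged so far; a site acts on its own input and on what has been exchanged on its own channel. The number of rounds is unrestricted. In a randomized protocol all parties may in addition use common random coins. The communication cost of a protocol is the total number of bits exchanged in both directions, in the worst case over the inputs and the coins. For points $u=(x_u,y_u)$ and $v=(x_v,y_v)$ in the plane, $u$ dominates $v$ ($u\succeq v$) if $x_u\ge x_v$ and $y_u\ge y_v$; the skyline of a finite set $S\subset\mathbb{R}^2$ is $sk(S)=\{u\in S \mid \forall v\in S,\ v\succeq u\Rightarrow v=u\}$. In the skyline problem under vertical partition with coordinates in $T\subseteq\mathbb{R}$, there are $n$ points with IDs $1,\dots,n$; Alice holds the $x$-coordinate in $T$ of every ID, Bob holds the $y$-coordinate in $T$ of every ID, and the coordinator has to output $sk(S)$, where $S=\{(x_i,y_i)\mid 1\le i\le n\}$. **Theorem.** There is an absolute constant $c>0$ such that for all $n\ge 0$ and all $T\subseteq\mathbb{R}$: 1. if $|T|\ge 2$, then every randomized protocol that on each input (different IDs being allowed to carry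 the same point) outputs $sk(S)$ with probability at least $0.51$ has communication cost at least $cn$, regardless of how many rounds it uses; 2. if $|T|\ge 2n$, then the same holds for protocols that are only required to succeed with probability at least $0.51$ on inputs in which the $n$ points are pairwise distinct, the cost being the worst case over these inputs and the coins. -/

import Mathlib

open MeasureTheory
open scoped NNReal ENNReal

/-! ### Skylines of planar point sets -/

/-- `u` dominates `v`: both coordinates of `u` are at least those of `v`. -/
def Dominates (u v : ℝ × ℝ) : Prop := v.1 ≤ u.1 ∧ v.2 ≤ u.2

open Classical in
/-- The skyline of a finite set of points in the plane: the points that are dominated by no other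
point of the set. -/
noncomputable def skyline (S : Finset (ℝ × ℝ)) : Finset (ℝ × ℝ) :=
  S.filter fun u => ∀ v ∈ S, Dominates v u → v = u

/-! ### The coordinator model with two sites -/

/-- A message is a non-empty bit string (sending a message costs at least one bit). -/
abbrev Message : Type := {m : List Bool // m ≠ []}

/-- What happens on the channel between the coordinator and one site in one round: nothing, if the
site is not contacted; otherwise the coordinator's message and the site's response. -/
abbrev Exchange : Type := Option (Message × Message)

/-- The number of bits sent (in both directions) in one exchange. -/
def Exchange.bits : Exchange → ℕ
  | none => 0
  | some (m, r) => m.1.length + r.1.length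

/-- The coordinator's move at the beginning of a round: either it sends messages to some of the two
sites, or it stops and announces an output. -/
inductive CoordinatorMove (O : Type*) where
  | contact (toAlice toBob : Option Message) : CoordinatorMove O
  | halt (output : O) : CoordinatorMove O

/-- A deterministic protocol in the coordinator model with two sites, Alice (input in `X`) and Bob
(input in `Y`). The coordinator has no input; its move depends on everything it has exchanged with
both sites in the earlier rounds. A contacted site responds according to its own input, what was
exchanged on its own channel in the earlier rounds, and the message it has just received. There is
no restriction on the number of rounds. -/
structure CoordinatorProtocol (X Y O : Type*) where
  coordinator : List (Exchange × Exchange) → CoordinatorMove O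
  alice : X → List Exchange → Message → Message
  bob : Y → List Exchange → Message → Message

namespace CoordinatorProtocol

variable {X Y O : Type*}

/-- The communication of the first `t` rounds on inputs `x`, `y`, round by round (Alice's channel,
Bob's channel); nothing is added once the coordinator has stopped. -/
def history (P : CoordinatorProtocol X Y O) (x : X) (y : Y) : ℕ → List (Exchange × Exchange)
  | 0 => []
  | t + 1 =>
    match P.coordinator (history P x y t) with
    | .halt _ => history P x y t
    | .contact a b =>
      history P x y t ++
        [(a.map fun m => (m, P.alice x ((history P x y t).map Prod.fst) m),
          b.map fun m => (m, P.bob y ((history P x y t).map Prod.snd) m))]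

/-- The total number of bits exchanged in the first `t` rounds on inputs `x`, `y`. -/
def bits (P : CoordinatorProtocol X Y O) (x : X) (y : Y) (t : ℕ) : ℕ :=
  ((P.history x y t).map fun e => e.1.bits + e.2.bits).sum

/-- On inputs `x`, `y` the coordinator eventually stops with output `o`. -/
def Outputs (P : CoordinatorProtocol X Y O) (x : X) (y : Y) (o : O) : Prop :=
  ∃ t, P.coordinator (P.history x y t) = .halt o

end CoordinatorProtocol

/-- The communication cost of a randomized protocol: the number of bits exchanged, in the worst case
over the admissible inputs and over the random coins `ω` (`⊤` if unbounded). A randomized protocol is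
a family of deterministic protocols indexed by the outcome of coins visible to all parties. -/
noncomputable def communicationCost {X Y O Ω : Type*} (P : Ω → CoordinatorProtocol X Y O)
    (Adm : X → Y → Prop) : ℕ∞ :=
  ⨆ (ω : Ω) (x : X) (y : Y) (_ : Adm x y) (t : ℕ), ((P ω).bits x y t : ℕ∞)

/-! ### The skyline problem under vertical partition -/

/-- The set of points obtained by joining on the IDs `0, …, n - 1` the table `x` of first coordinates
and the table `y` of second coordinates. -/
noncomputable def joinedPoints {n : ℕ} {T : Set ℝ} (x y : Fin n → T) : Finset (ℝ × ℝ) :=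
  Finset.univ.image fun i => ((x i : ℝ), (y i : ℝ))

/-- Deterministic protocols for `n` points with IDs `0, …, n - 1` and coordinates in `T`, vertically
partitioned: Alice holds the first coordinate of every ID, Bob the second coordinate of every ID. The
output is a finite set of points. -/
abbrev VerticalProtocol (n : ℕ) (T : Set ℝ) : Type :=
  CoordinatorProtocol (Fin n → T) (Fin n → T) (Finset (ℝ × ℝ))

/-- On every admissible input, the randomized protocol outputs the skyline with probability at
least `p`. -/
def ComputesSkyline {n : ℕ} {T : Set ℝ} {Ω : Type*} [MeasurableSpace Ω] (μ : Measure Ω)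
    (P : Ω → VerticalProtocol n T) (Adm : (Fin n → T) → (Fin n → T) → Prop) (p : ℝ) : Prop :=
  ∀ x y, Adm x y →
    MeasurableSet {ω | (P ω).Outputs x y (skyline (joinedPoints x y))} ∧
      p ≤ μ.real {ω | (P ω).Outputs x y (skyline (joinedPoints x y))}

/-- All inputs; different IDs may carry the same point. -/
def AnyPoints {n : ℕ} {T : Set ℝ} (_x _y : Fin n → T) : Prop := True

/-- Inputs in which different IDs carry different points. -/
def DistinctPoints {n : ℕ} {T : Set ℝ} (x y : Fin n → T) : Prop :=
  Function.Injective fun i => (x i, y i)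

/-! Part 1 is a reduction from set disjointness. For `a < b` in `T`, Boolean vectors become
coordinate vectors with entries `a` and `b`; since `(b, b)` dominates every possible point, the
skyline is `{(b, b)}` exactly when the two sets meet.

Disjointness is hard by a corruption argument. A hard disjoint pair is drawn by splitting the
coordinates between the parties with a random mask and letting each party choose a uniform subset of
its share; a hard intersecting pair arises by planting one common element `i`. On a rectangle of
large mass, most coordinates are nearly unbiased by the level-one inequality `sum_sq_bias_le_log`,
so planting costs little: `rectangle_corruption` shows that the planted mass, averaged over `i`, is
at least 0.98 times the disjoint mass, up to an exponentially small error. Histories partition the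
inputs into rectangles (`history_rectangle`), and a Kraft inequality bounds their number by `4 ^ C`
(`card_histories_le`). Were `C` a small multiple of `n`, a protocol answering "disjoint" with
probability 0.51 on disjoint pairs would err with probability almost 0.98 · 0.51 > 0.49 on planted
ones. Because the factor is so close to 1, no amplification of the success probability is needed.

Part 2 is counting: with `2n` values available there are `2 ^ n` staircases of distinct points, each
its own skyline, and for fixed coins a protocol is correct on at most `4 ^ C` inputs with different
answers (`mul_card_le_four_pow`). -/

open Finset Function Real
open scoped BigOperators

/-! ### Masks -/

section Mask

variable {ι : Type*}

/-- Coordinatewise conjunction. -/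
def mask (D r : ι → Bool) : ι → Bool := fun i => D i && r i

theorem mask_update [DecidableEq ι] (D r : ι → Bool) (i : ι) (c : Bool) :
    mask D (update r i c) = update (mask D r) i (D i && c) := by
  ext j
  by_cases h : j = i
  · subst h; simp [mask]
  · simp [mask, h]

theorem update_mask_update [DecidableEq ι] (D r : ι → Bool) (i : ι) (b c : Bool) :
    update (mask (update D i c) r) i b = update (mask D r) i b := by
  ext j
  by_cases h : j = i
  · subst h; simp
  · simp [mask, h]

/-- The complementary mask. -/
def maskCompl (D : ι → Bool) : ι → Bool := fun i => !D i

theorem maskCompl_update [DecidableEq ι] (D : ι → Bool) (i : ι) (c : Bool) :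
    maskCompl (update D i c) = update (maskCompl D) i (!c) := by
  ext j
  by_cases h : j = i
  · subst h; simp [maskCompl]
  · simp [maskCompl, h]

theorem exists_common_of_update [DecidableEq ι] (x y : ι → Bool) (i : ι) :
    ∃ j, update x i true j = true ∧ update y i true j = true := ⟨i, by simp⟩

theorem not_exists_common_of_mask (D r s : ι → Bool) :
    ¬∃ j, mask D r j = true ∧ mask (maskCompl D) s j = true := by
  rintro ⟨j, h1, h2⟩
  simp only [mask, maskCompl, Bool.and_eq_true, Bool.not_eq_true'] at h1 h2
  simp [h1.1] at h2

end Mask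

/-! ### Averages over the Boolean cube -/

section Cube

variable {ι : Type*} [Fintype ι] [DecidableEq ι]

/-- The character of `Bool` as a real number: `-1` at `true`, `1` at `false`. -/
def boolSign (b : Bool) : ℝ := if b then -1 else 1

theorem expect_cube_eq_expect_update (i : ι) (g : (ι → Bool) → ℝ) :
    𝔼 D, g D = 𝔼 D, (g (update D i true) + g (update D i false)) / 2 := by
  have hinv : Involutive fun D : ι → Bool => update D i (!D i) := by
    intro D
    simp
  have h : 𝔼 D, g D = 𝔼 D, g (update D i (!D i)) :=
    (Fintype.expect_bijective _ hinv.bijective _ _ fun _ => rfl).symm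
  have h2 : ∀ D, (g (update D i true) + g (update D i false)) / 2 =
      (g D + g (update D i (!D i))) / 2 := by
    intro D
    rcases hD : D i with _ | _
    · have : update D i false = D := by rw [← hD]; simp
      rw [this, Bool.not_false, add_comm]
    · have : update D i true = D := by rw [← hD]; simp
      rw [this, Bool.not_true]
  simp_rw [h2]
  rw [← expect_div, expect_add_distrib, ← h]
  ring

theorem expect_cube_prod (g : ι → Bool → ℝ) :
    𝔼 r : ι → Bool, ∏ i, g i (r i) = ∏ i, (g i true + g i false) / 2 := by
  rw [Fintype.expect_eq_sum_div_card, prod_div_distrib]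
  congr 1
  · have := Finset.prod_univ_sum (fun _ : ι => (univ : Finset Bool)) g
    simp only [Fintype.sum_bool] at this
    rw [this, Fintype.piFinset_univ]
  · simp

/-- Level-one inequality: a `[0, 1]`-valued function on the cube with mean `a > 0` has relative
biases whose squares sum to at most `2 log (1 / a)`. -/
theorem sum_sq_bias_le_log (f : (ι → Bool) → ℝ) (hf0 : ∀ r, 0 ≤ f r) (hf1 : ∀ r, f r ≤ 1)
    (ha : 0 < 𝔼 r, f r) :
    ∑ i, ((𝔼 r, boolSign (r i) * f r) / 𝔼 r, f r) ^ 2 ≤ -(2 * log (𝔼 r, f r)) := by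
  set a := 𝔼 r, f r with ha_def
  set b : ι → ℝ := fun i => (𝔼 r, boolSign (r i) * f r) / a with hb
  set N : ℝ := (Fintype.card (ι → Bool) : ℝ) with hN
  have hNpos : 0 < N := by simp [hN]
  have hsum : ∑ r, f r = N * a := by
    rw [ha_def, Fintype.expect_eq_sum_div_card, mul_div_cancel₀ _ hNpos.ne']
  have hw : ∑ r, f r / (N * a) = 1 := by
    rw [← sum_div, hsum, div_self (by positivity)]
  have hmean : ∑ r, (f r / (N * a)) • (∑ i, b i * boolSign (r i)) = ∑ i, b i ^ 2 := by
    simp_rw [smul_eq_mul, mul_sum]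
    rw [sum_comm]
    refine sum_congr rfl fun i _ => ?_
    have : ∑ r, boolSign (r i) * f r = N * (b i * a) := by
      rw [hb]
      simp only
      rw [div_mul_cancel₀ _ ha.ne', Fintype.expect_eq_sum_div_card, mul_div_cancel₀ _ hNpos.ne']
    calc ∑ r, f r / (N * a) * (b i * boolSign (r i))
        = (b i / (N * a)) * ∑ r, boolSign (r i) * f r := by
          rw [mul_sum]; exact sum_congr rfl fun r _ => by ring
      _ = b i ^ 2 := by rw [this]; field_simp
  -- Jensen under the density proportional to `f`, applied to the linear form with coefficients `b
  -- i`, whose mean is `∑ b i ^ 2`. Since `f ≤ 1`, passing to the uniform measure costs a factor `1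
  -- / a`; there the exponential moment is `∏ cosh (b i) ≤ exp (∑ b i ^ 2 / 2)`.
  have hJ := convexOn_exp.map_sum_le (t := univ) (w := fun r => f r / (N * a))
    (p := fun r => ∑ i, b i * boolSign (r i)) (fun r _ => by have := hf0 r; positivity) hw
    (fun _ _ => Set.mem_univ _)
  rw [hmean] at hJ
  have hexp : ∑ r, (f r / (N * a)) • exp (∑ i, b i * boolSign (r i)) ≤
      a⁻¹ * 𝔼 r : ι → Bool, ∏ i, exp (b i * boolSign (r i)) := by
    rw [Fintype.expect_eq_sum_div_card, ← hN, ← mul_div_assoc, mul_sum, sum_div]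
    refine sum_le_sum fun r _ => ?_
    rw [exp_sum, smul_eq_mul]
    have : f r / (N * a) ≤ 1 / (N * a) := by gcongr; exact hf1 r
    calc f r / (N * a) * ∏ i, exp (b i * boolSign (r i))
        ≤ 1 / (N * a) * ∏ i, exp (b i * boolSign (r i)) := by
          gcongr
      _ = _ := by field_simp
  have hprod : 𝔼 r : ι → Bool, ∏ i, exp (b i * boolSign (r i)) ≤ exp (∑ i, b i ^ 2 / 2) := by
    rw [expect_cube_prod fun i c => exp (b i * boolSign c), exp_sum]
    refine prod_le_prod (fun i _ => by positivity) fun i _ => ?_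
    refine le_trans (le_of_eq ?_) (cosh_le_exp_half_sq (b i))
    rw [cosh_eq]
    simp [boolSign, add_comm]
  have h := hJ.trans (hexp.trans (mul_le_mul_of_nonneg_left hprod (by positivity)))
  have h2 := log_le_log (exp_pos _) h
  rw [log_exp, log_mul (by positivity) (exp_pos _).ne', log_exp, log_inv, ← sum_div] at h2
  linarith

/-! ### Biases on masked subcubes -/

/-- The mean of `φ` on the subcube of points supported on `D`. -/
noncomputable def maskedMean (φ : (ι → Bool) → ℝ) (D : ι → Bool) : ℝ := 𝔼 r, φ (mask D r)

/-- The mean of `φ` on the subcube of points supported on `D`, with coordinate `i` replaced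
by `b`. -/
noncomputable def pinnedMean (φ : (ι → Bool) → ℝ) (i : ι) (b : Bool) (D : ι → Bool) : ℝ :=
  𝔼 r, φ (update (mask D r) i b)

/-- The relative bias of coordinate `i` under `φ` on the subcube of points supported on `D`. -/
noncomputable def relBias (φ : (ι → Bool) → ℝ) (i : ι) (D : ι → Bool) : ℝ :=
  (pinnedMean φ i false D - pinnedMean φ i true D) /
    (pinnedMean φ i false D + pinnedMean φ i true D)

variable {φ ψ : (ι → Bool) → ℝ}

theorem pinnedMean_update (i : ι) (b c : Bool) (D : ι → Bool) :
    pinnedMean φ i b (update D i c) = pinnedMean φ i b D := by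
  simp_rw [pinnedMean, update_mask_update]

theorem relBias_update (i : ι) (c : Bool) (D : ι → Bool) :
    relBias φ i (update D i c) = relBias φ i D := by
  simp_rw [relBias, pinnedMean_update]

theorem maskedMean_of_true {i : ι} {D : ι → Bool} (h : D i = true) :
    maskedMean φ D = (pinnedMean φ i false D + pinnedMean φ i true D) / 2 := by
  rw [maskedMean, expect_cube_eq_expect_update i]
  simp_rw [mask_update, h, Bool.true_and]
  rw [← expect_div, expect_add_distrib, add_comm]
  rfl

theorem maskedMean_of_false {i : ι} {D : ι → Bool} (h : D i = false) :
    maskedMean φ D = pinnedMean φ i false D := by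
  refine expect_congr rfl fun r _ => ?_
  congr 1
  ext j
  by_cases hj : j = i
  · subst hj; simp [mask, h]
  · simp [hj]

theorem expect_boolSign_mul_mask {i : ι} {D : ι → Bool} (h : D i = true) :
    𝔼 r, boolSign (r i) * φ (mask D r) =
      (pinnedMean φ i false D - pinnedMean φ i true D) / 2 := by
  rw [expect_cube_eq_expect_update i]
  simp_rw [mask_update, h, Bool.true_and]
  simp only [update_self, boolSign, if_true, Bool.false_eq_true, if_false]
  rw [← expect_div, expect_add_distrib]
  simp only [neg_mul, one_mul, expect_neg_distrib]
  rw [pinnedMean, pinnedMean]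
  ring

theorem maskedMean_nonneg (h0 : ∀ x, 0 ≤ φ x) (D : ι → Bool) : 0 ≤ maskedMean φ D :=
  expect_nonneg fun _ _ => h0 _

theorem pinnedMean_nonneg (h0 : ∀ x, 0 ≤ φ x) (i : ι) (b : Bool) (D : ι → Bool) :
    0 ≤ pinnedMean φ i b D :=
  expect_nonneg fun _ _ => h0 _

/-- The level-one inequality on the subcube of `D`, multiplied by the mean so that it survives mean
zero. Coordinates outside `D` are simply dropped. -/
theorem maskedMean_mul_sum_relBias_sq_le (h0 : ∀ x, 0 ≤ φ x) (h1 : ∀ x, φ x ≤ 1)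
    (D : ι → Bool) :
    maskedMean φ D * ∑ i, (if D i then relBias φ i D ^ 2 else 0) ≤
      2 * negMulLog (maskedMean φ D) := by
  rcases (maskedMean_nonneg h0 D).eq_or_lt with h | h
  · simp [← h]
  · have hle : ∑ i, (if D i then relBias φ i D ^ 2 else 0) ≤
        ∑ i, ((𝔼 r, boolSign (r i) * φ (mask D r)) / maskedMean φ D) ^ 2 := by
      refine sum_le_sum fun i _ => ?_
      split_ifs with hi
      · rw [expect_boolSign_mul_mask hi, maskedMean_of_true hi, div_div_div_cancel_right₀
          (by norm_num), relBias]
      · positivity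
    have := sum_sq_bias_le_log (fun r => φ (mask D r)) (fun _ => h0 _) (fun _ => h1 _) h
    calc _ ≤ maskedMean φ D * -(2 * log (maskedMean φ D)) := by
          gcongr; exact hle.trans this
      _ = _ := by rw [negMulLog]; ring

theorem bias_polynomial_inequality {β γ : ℝ} (hβ : |β| ≤ 1) (hγ : |γ| ≤ 1) :
    0.99 * (1 + (β + γ) / 2) - 1000 * ((1 + γ) * β ^ 2 + (1 + β) * γ ^ 2) ≤
      (1 - β) * (1 - γ) := by
  rw [abs_le] at hβ hγ
  have hQ0 : 0 ≤ (1 + γ) * β ^ 2 + (1 + β) * γ ^ 2 :=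
    add_nonneg (mul_nonneg (by linarith) (sq_nonneg _)) (mul_nonneg (by linarith) (sq_nonneg _))
  -- For `β + γ ≥ 0` the penalty is at least `500 * (β ^ 2 + γ ^ 2)`, which together with the slack
  -- 0.01 absorbs the linear terms. For `β + γ < 0` the linear terms help, and the penalty is needed
  -- only against a negative `β * γ`.
  by_cases hb : 0 ≤ β + γ
  · have hQ : (β ^ 2 + γ ^ 2) / 2 ≤ (1 + γ) * β ^ 2 + (1 + β) * γ ^ 2 := by
      by_cases hp : 0 ≤ β * γ
      · nlinarith [mul_nonneg hp hb, sq_nonneg β, sq_nonneg γ]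
      · have : β + γ ≤ 1 := by
          by_contra hc
          push Not at hc hp
          nlinarith
        nlinarith [mul_nonneg (sub_nonneg.2 this) (neg_nonneg.2 (not_le.1 hp).le), sq_nonneg (β + γ)]
    nlinarith [sq_nonneg (β - 1 / 200), sq_nonneg (γ - 1 / 200), sq_nonneg (β + γ)]
  · push Not at hb
    by_cases hp : 0 ≤ β * γ
    · nlinarith
    · have hQ : β ^ 2 + γ ^ 2 ≤ (1 + γ) * β ^ 2 + (1 + β) * γ ^ 2 := by
        nlinarith [mul_pos_of_neg_of_neg hb (not_le.1 hp)]
      nlinarith [sq_nonneg (β + γ)]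

theorem exists_bias {p q : ℝ} (hp : 0 ≤ p) (hq : 0 ≤ q) :
    ∃ β : ℝ, |β| ≤ 1 ∧ p = (p + q) / 2 * (1 + β) ∧ q = (p + q) / 2 * (1 - β) ∧
      (p - q) / (p + q) = β := by
  refine ⟨(p - q) / (p + q), ?_, ?_, ?_, rfl⟩
  · rw [abs_div, abs_of_nonneg (add_nonneg hp hq)]
    refine div_le_one_of_le₀ ?_ (add_nonneg hp hq)
    rw [abs_le]; constructor <;> linarith
  all_goals
    -- If `p + q = 0`, then `p = q = 0`, and the bias is 0 by the convention for division by zero.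
    rcases (add_nonneg hp hq).eq_or_lt with h | h
    · rw [← h]; simp; linarith
    · field_simp; ring

/-- Here `p` and `q` are the masses of the two sides with the coordinate pinned to 0 or 1. The
disjoint mass averages over which party owns the coordinate, the other party being pinned to 0.
Writing each pair as mean times `1 ± bias` reduces this to `bias_polynomial_inequality`. -/
theorem rectangle_local_inequality {p₀ p₁ q₀ q₁ : ℝ} (hp₀ : 0 ≤ p₀) (hp₁ : 0 ≤ p₁)
    (hq₀ : 0 ≤ q₀) (hq₁ : 0 ≤ q₁) :
    0.99 * (((p₀ + p₁) / 2 * q₀ + p₀ * ((q₀ + q₁) / 2)) / 2) -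
      2000 * ((((p₀ - p₁) / (p₀ + p₁)) ^ 2 * ((p₀ + p₁) / 2 * q₀) +
        ((q₀ - q₁) / (q₀ + q₁)) ^ 2 * (p₀ * ((q₀ + q₁) / 2))) / 2) ≤ p₁ * q₁ := by
  obtain ⟨β, hβ, hp0, hp1, hpe⟩ := exists_bias hp₀ hp₁
  obtain ⟨γ, hγ, hq0, hq1, hqe⟩ := exists_bias hq₀ hq₁
  rw [hpe, hqe]
  have ha : 0 ≤ (p₀ + p₁) / 2 := by positivity
  have hb : 0 ≤ (q₀ + q₁) / 2 := by positivity
  generalize (p₀ + p₁) / 2 = a at *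
  generalize (q₀ + q₁) / 2 = b at *
  have := mul_le_mul_of_nonneg_left (bias_polynomial_inequality hβ hγ) (mul_nonneg ha hb)
  subst hp0 hp1 hq0 hq1
  nlinarith [this]

/-- Masks differing only at `i` are paired. Pinned means and biases at `i` do not depend on `D i`,
so each pair is an instance of the local inequality; the squared bias is charged to the owner of
`i`. -/
theorem expect_pinned_ge (h0 : ∀ x, 0 ≤ φ x) (k0 : ∀ x, 0 ≤ ψ x) (i : ι) :
    0.99 * (𝔼 D, maskedMean φ D * maskedMean ψ (maskCompl D)) -
      2000 * (𝔼 D, ((if D i then relBias φ i D ^ 2 else 0) +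
        (if maskCompl D i then relBias ψ i (maskCompl D) ^ 2 else 0)) *
          (maskedMean φ D * maskedMean ψ (maskCompl D))) ≤
      𝔼 D, pinnedMean φ i true D * pinnedMean ψ i true (maskCompl D) := by
  rw [expect_cube_eq_expect_update i, expect_cube_eq_expect_update i (fun D =>
    ((if D i then relBias φ i D ^ 2 else 0) +
        (if maskCompl D i then relBias ψ i (maskCompl D) ^ 2 else 0)) *
          (maskedMean φ D * maskedMean ψ (maskCompl D))), mul_expect, mul_expect,
    ← expect_sub_distrib]
  refine expect_le_expect fun D _ => ?_
  have key := rectangle_local_inequality (pinnedMean_nonneg h0 i false D)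
    (pinnedMean_nonneg h0 i true D) (pinnedMean_nonneg k0 i false (maskCompl D))
    (pinnedMean_nonneg k0 i true (maskCompl D))
  simp only [maskCompl_update, relBias_update, update_self, Bool.not_true, Bool.not_false, if_true,
    Bool.false_eq_true, if_false, add_zero, zero_add]
  rw [maskedMean_of_true (φ := φ) (update_self i true D),
    maskedMean_of_false (φ := φ) (update_self i false D),
    maskedMean_of_true (φ := ψ) (update_self i true (maskCompl D)),
    maskedMean_of_false (φ := ψ) (update_self i false (maskCompl D))]
  simp only [pinnedMean_update]
  exact key

/-- The tangent to the concave function `negMulLog` at `exp (-L)` is `(L - 1) * u + exp (-L)`. The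
slope `L` is free, trading a multiple of the mass against an exponentially small error. -/
theorem negMulLog_le_mul_add_exp {u : ℝ} (hu : 0 ≤ u) (L : ℝ) :
    negMulLog u ≤ L * u + exp (-L) := by
  rcases hu.eq_or_lt with rfl | hu
  · simp; positivity
  · have h := log_le_sub_one_of_pos (show 0 < exp (-L) / u by positivity)
    rw [log_div (exp_pos _).ne' hu.ne', log_exp] at h
    have := mul_le_mul_of_nonneg_left h hu.le
    rw [mul_sub, mul_sub, mul_div_cancel₀ _ hu.ne'] at this
    rw [negMulLog]
    linarith

/-- Corruption bound for a product function `φ ⊗ ψ`: its mean over pairs meeting in one planted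
coordinate is not much smaller than its mean over disjoint pairs. -/
theorem rectangle_corruption (h0 : ∀ x, 0 ≤ φ x) (h1 : ∀ x, φ x ≤ 1) (k0 : ∀ x, 0 ≤ ψ x)
    (k1 : ∀ x, ψ x ≤ 1) :
    0.98 * (Fintype.card ι : ℝ) * (𝔼 D, maskedMean φ D * maskedMean ψ (maskCompl D)) -
      4000 * exp (-((Fintype.card ι : ℝ) / 400000)) ≤
      ∑ i, 𝔼 D, pinnedMean φ i true D * pinnedMean ψ i true (maskCompl D) := by
  set n : ℝ := (Fintype.card ι : ℝ) with hn
  set E := 𝔼 D, maskedMean φ D * maskedMean ψ (maskCompl D) with hE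
  have hS := sum_le_sum fun i (_ : i ∈ univ) => expect_pinned_ge h0 k0 i
  rw [sum_sub_distrib, sum_const, card_univ, nsmul_eq_mul, ← mul_sum, ← expect_sum_comm] at hS
  -- The slope `n / 400000` makes the total penalty `2000 * 2 * (n / 400000) * E = 0.01 * n * E`,
  -- lowering 0.99 to 0.98; the error is `2000 * 2 = 4000` exponentials.
  have hT : 𝔼 D, ∑ i, ((if D i then relBias φ i D ^ 2 else 0) +
        (if maskCompl D i then relBias ψ i (maskCompl D) ^ 2 else 0)) *
          (maskedMean φ D * maskedMean ψ (maskCompl D)) ≤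
      2 * (n / 400000 * E + exp (-(n / 400000))) := by
    have : 2 * (n / 400000 * E + exp (-(n / 400000))) =
        𝔼 D : ι → Bool, 2 * (n / 400000 * (maskedMean φ D * maskedMean ψ (maskCompl D)) +
          exp (-(n / 400000))) := by
      rw [← mul_expect, expect_add_distrib, ← mul_expect, Fintype.expect_const]
    rw [this]
    refine expect_le_expect fun D _ => ?_
    have hF := maskedMean_nonneg h0 D
    have hG := maskedMean_nonneg k0 (maskCompl D)
    have e1 := mul_le_mul_of_nonneg_left (maskedMean_mul_sum_relBias_sq_le h0 h1 D) hG
    have e2 := mul_le_mul_of_nonneg_left (maskedMean_mul_sum_relBias_sq_le k0 k1 (maskCompl D)) hF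
    have e3 := negMulLog_le_mul_add_exp (mul_nonneg hF hG) (n / 400000)
    -- The product rule for `negMulLog` merges the entropy costs of the two sides into that of the
    -- rectangle mass.
    rw [negMulLog_mul] at e3
    rw [← sum_mul, sum_add_distrib]
    linarith
  rw [← hE, ← hn] at hS
  linarith

end Cube

/-! ### Communication histories -/

instance : DecidableEq Message := inferInstanceAs (DecidableEq {m : List Bool // m ≠ []})

instance : DecidableEq Exchange := inferInstanceAs (DecidableEq (Option (Message × Message)))

/-- Messages need not be prefix-free, so weight 1/2 per bit would diverge; with 1/4 the `2 ^ L`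
strings of length `L` contribute at most `2 ^ (-L)`. -/
theorem sum_quarter_pow_length_le (F : Finset (List Bool)) :
    ∑ l ∈ F, (1 / 4 : ℝ) ^ l.length ≤ 2 := by
  have hcard : ∀ L : ℕ, #{l ∈ F | l.length = L} ≤ 2 ^ L := by
    intro L
    have hsub : {l ∈ F | l.length = L} ⊆
        (univ : Finset (List.Vector Bool L)).image List.Vector.toList := by
      intro l hl
      rw [mem_filter] at hl
      exact mem_image.2 ⟨⟨l, hl.2⟩, mem_univ _, rfl⟩
    refine (card_le_card hsub).trans (card_image_le.trans ?_)
    rw [card_univ, card_vector, Fintype.card_bool]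
  set M := F.sup List.length + 1 with hM
  have hmaps : ∀ l ∈ F, l.length ∈ range M := fun l hl =>
    mem_range.2 (Nat.lt_succ_of_le (le_sup (f := List.length) hl))
  rw [← sum_fiberwise_of_maps_to hmaps]
  calc ∑ L ∈ range M, ∑ l ∈ F with l.length = L, (1 / 4 : ℝ) ^ l.length
      ≤ ∑ L ∈ range M, (1 / 2 : ℝ) ^ L := by
        refine sum_le_sum fun L _ => ?_
        rw [sum_congr rfl fun l hl => by rw [(mem_filter.1 hl).2], sum_const, nsmul_eq_mul]
        have : (#{l ∈ F | l.length = L} : ℝ) ≤ 2 ^ L := by exact_mod_cast hcard L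
        calc (#{l ∈ F | l.length = L} : ℝ) * (1 / 4) ^ L ≤ 2 ^ L * (1 / 4) ^ L := by gcongr
          _ = (1 / 2) ^ L := by rw [← mul_pow]; norm_num
    _ ≤ ∑' L : ℕ, (1 / 2 : ℝ) ^ L :=
        summable_geometric_two.sum_le_tsum _ fun _ _ => by positivity
    _ = 2 := tsum_geometric_two

/-- The exchanges in which the coordinator sends a fixed message, or none, satisfy a Kraft
inequality. -/
theorem sum_quarter_pow_exchange_bits_le_one (a : Option Message) (F : Finset Exchange)
    (hF : ∀ e ∈ F, ∃ r : Message → Message, e = a.map fun m => (m, r m)) :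
    ∑ e ∈ F, (1 / 4 : ℝ) ^ e.bits ≤ 1 := by
  classical
  rcases a with _ | m
  · have hsub : F ⊆ {none} := by
      intro e he
      obtain ⟨r, hr⟩ := hF e he
      simpa using hr
    refine (sum_le_sum_of_subset_of_nonneg hsub fun _ _ _ => by positivity).trans ?_
    simp [Exchange.bits]
  · let resp : Exchange → List Bool := fun e => (e.map fun p => p.2.1).getD []
    have hinj : Set.InjOn resp F := by
      intro e he e' he' h
      obtain ⟨r, rfl⟩ := hF e he
      obtain ⟨r', rfl⟩ := hF e' he'
      have h' : (r m).1 = (r' m).1 := h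
      simp [Subtype.ext h']
    have hle : ∀ e ∈ F, (1 / 4 : ℝ) ^ e.bits ≤ 1 / 4 * (1 / 4) ^ (resp e).length := by
      intro e he
      obtain ⟨r, rfl⟩ := hF e he
      -- The coordinator's message is non-empty, and its factor 1/4 outweighs the sum 2 over all
      -- responses.
      have hm : 1 ≤ m.1.length := List.length_pos_of_ne_nil m.2
      change (1 / 4 : ℝ) ^ (m.1.length + (r m).1.length) ≤ 1 / 4 * (1 / 4) ^ (r m).1.length
      rw [← pow_succ']
      exact pow_le_pow_of_le_one (by norm_num) (by norm_num) (by omega)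
    calc ∑ e ∈ F, (1 / 4 : ℝ) ^ e.bits ≤ 1 / 4 * ∑ e ∈ F, (1 / 4 : ℝ) ^ (resp e).length := by
          rw [mul_sum]; exact sum_le_sum hle
      _ = 1 / 4 * ∑ l ∈ F.image resp, (1 / 4 : ℝ) ^ l.length := by rw [sum_image hinj]
      _ ≤ 1 / 4 * 2 := by gcongr; exact sum_quarter_pow_length_le _
      _ ≤ 1 := by norm_num

namespace CoordinatorProtocol

variable {X Y O : Type*} (P : CoordinatorProtocol X Y O)

/-- The total number of bits recorded in a list of exchanges. -/
def historyBits (h : List (Exchange × Exchange)) : ℕ := (h.map fun e => e.1.bits + e.2.bits).sum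

theorem historyBits_append_singleton (h : List (Exchange × Exchange)) (e : Exchange × Exchange) :
    historyBits (h ++ [e]) = historyBits h + (e.1.bits + e.2.bits) := by
  simp [historyBits]

variable {P}

theorem history_succ_of_halt {x : X} {y : Y} {t : ℕ} {o : O}
    (h : P.coordinator (P.history x y t) = .halt o) :
    P.history x y (t + 1) = P.history x y t := by
  rw [history, h]

theorem history_succ_of_contact {x : X} {y : Y} {t : ℕ} {a b : Option Message}
    (h : P.coordinator (P.history x y t) = .contact a b) :
    P.history x y (t + 1) = P.history x y t ++
        [(a.map fun m => (m, P.alice x ((P.history x y t).map Prod.fst) m),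
          b.map fun m => (m, P.bob y ((P.history x y t).map Prod.snd) m))] := by
  rw [history, h]

theorem length_history_le (x : X) (y : Y) (t : ℕ) : (P.history x y t).length ≤ t := by
  induction t with
  | zero => simp [history]
  | succ t ih =>
    rcases h : P.coordinator (P.history x y t) with ⟨a, b⟩ | o
    · rw [history_succ_of_contact h]; simpa using ih
    · rw [history_succ_of_halt h]; omega

theorem length_history_of_contact {x : X} {y : Y} {t : ℕ} {a b : Option Message}
    (h : P.coordinator (P.history x y t) = .contact a b) : (P.history x y t).length = t := by
  induction t generalizing a b with
  | zero => simp [history]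
  | succ t ih =>
    rcases h' : P.coordinator (P.history x y t) with ⟨a', b'⟩ | o
    · rw [history_succ_of_contact h']; simpa using ih h'
    · rw [history_succ_of_halt h', h'] at h; cases h

theorem take_history_succ (x : X) (y : Y) (t : ℕ) :
    (P.history x y (t + 1)).take t = P.history x y t := by
  rcases h : P.coordinator (P.history x y t) with ⟨a, b⟩ | o
  · rw [history_succ_of_contact h]
    exact List.take_left' (length_history_of_contact h)
  · rw [history_succ_of_halt h]
    exact List.take_of_length_le (length_history_le x y t)

/-- The inputs with a given history form a rectangle. -/
theorem history_rectangle {x x' : X} {y y' : Y} {t : ℕ}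
    (h : P.history x y t = P.history x' y' t) : P.history x y' t = P.history x y t := by
  induction t with
  | zero => simp [history]
  | succ t ih =>
    have h0 : P.history x y t = P.history x' y' t := by
      rw [← take_history_succ, h, take_history_succ]
    have h1 := ih h0
    rcases hc : P.coordinator (P.history x y t) with ⟨a, b⟩ | o
    · have hc1 := hc; rw [← h1] at hc1
      have hc2 := hc; rw [h0] at hc2
      rw [history_succ_of_contact hc, history_succ_of_contact hc2, ← h0] at h
      rw [history_succ_of_contact hc, history_succ_of_contact hc1, h1]
      have h' := List.append_cancel_left h
      simp only [List.cons.injEq, Prod.mk.injEq, and_true] at h'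
      rw [h'.2]
    · have hc1 := hc; rw [← h1] at hc1
      rw [history_succ_of_halt hc, history_succ_of_halt hc1, h1]

theorem history_eq_of_halt {x : X} {y : Y} {t : ℕ} {o : O}
    (h : P.coordinator (P.history x y t) = .halt o) {t' : ℕ} (ht : t ≤ t') :
    P.history x y t' = P.history x y t := by
  induction t', ht using Nat.le_induction with
  | base => rfl
  | succ k _ ih => rw [history_succ_of_halt (o := o) (by rw [ih, h]), ih]

/-- Kraft inequality for the histories that occur on finitely many inputs. -/
theorem sum_quarter_pow_historyBits_le_one (s : Finset (X × Y))
    (t : ℕ) :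
    ∑ h ∈ s.image (fun p => P.history p.1 p.2 t), (1 / 4 : ℝ) ^ historyBits h ≤ 1 := by
  induction t with
  | zero =>
    have hsub : s.image (fun p => P.history p.1 p.2 0) ⊆ {[]} := by
      intro h hh
      simpa [history] using (mem_image.1 hh).elim fun p hp => hp.2.symm
    refine (sum_le_sum_of_subset_of_nonneg hsub fun _ _ _ => by positivity).trans ?_
    simp [historyBits]
  | succ t ih =>
    have hmaps : ∀ h ∈ s.image (fun p => P.history p.1 p.2 (t + 1)),
        h.take t ∈ s.image (fun p => P.history p.1 p.2 t) := by
      intro h hh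
      obtain ⟨p, hp, rfl⟩ := mem_image.1 hh
      rw [take_history_succ]
      exact mem_image_of_mem _ hp
    rw [← sum_fiberwise_of_maps_to hmaps]
    refine (sum_le_sum fun h _ => ?_).trans ih
    -- The earlier history fixes the coordinator's move, so its extensions lie in a product of
    -- exchange sets, one per site, and the sum factors.
    rcases hc : P.coordinator h with ⟨a, b⟩ | o
    · set RA : Finset Exchange :=
        s.image fun p => a.map fun m => (m, P.alice p.1 (h.map Prod.fst) m) with hRA
      set RB : Finset Exchange :=
        s.image fun p => b.map fun m => (m, P.bob p.2 (h.map Prod.snd) m) with hRB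
      have hsub : {h' ∈ s.image (fun p => P.history p.1 p.2 (t + 1)) | h'.take t = h} ⊆
          (RA ×ˢ RB).image fun e => h ++ [e] := by
        intro h' hh'
        obtain ⟨hh', htake⟩ := mem_filter.1 hh'
        obtain ⟨p, hp, rfl⟩ := mem_image.1 hh'
        rw [take_history_succ] at htake
        subst htake
        rw [history_succ_of_contact hc]
        exact mem_image_of_mem _ (mem_product.2 ⟨mem_image_of_mem _ hp, mem_image_of_mem _ hp⟩)
      refine (sum_le_sum_of_subset_of_nonneg hsub fun _ _ _ => by positivity).trans ?_
      rw [sum_image (fun e _ e' _ hee => by simpa using hee)]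
      simp_rw [historyBits_append_singleton, pow_add]
      rw [← mul_sum, sum_product]
      dsimp only
      rw [← sum_mul_sum]
      have hA : ∑ e ∈ RA, (1 / 4 : ℝ) ^ e.bits ≤ 1 :=
        sum_quarter_pow_exchange_bits_le_one a RA fun e he => by
          obtain ⟨p, _, rfl⟩ := mem_image.1 he
          exact ⟨_, rfl⟩
      have hB : ∑ e ∈ RB, (1 / 4 : ℝ) ^ e.bits ≤ 1 :=
        sum_quarter_pow_exchange_bits_le_one b RB fun e he => by
          obtain ⟨p, _, rfl⟩ := mem_image.1 he
          exact ⟨_, rfl⟩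
      exact mul_le_of_le_one_right (by positivity)
        (mul_le_one₀ hA (sum_nonneg fun _ _ => by positivity) hB)
    · have hsub : {h' ∈ s.image (fun p => P.history p.1 p.2 (t + 1)) | h'.take t = h} ⊆ {h} := by
        intro h' hh'
        obtain ⟨hh', htake⟩ := mem_filter.1 hh'
        obtain ⟨p, hp, rfl⟩ := mem_image.1 hh'
        rw [take_history_succ] at htake
        subst htake
        rw [history_succ_of_halt hc]
        exact mem_singleton_self _
      refine (sum_le_sum_of_subset_of_nonneg hsub fun _ _ _ => by positivity).trans ?_
      simp

theorem card_histories_le (s : Finset (X × Y)) (t C : ℕ)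
    (hC : ∀ p ∈ s, P.bits p.1 p.2 t ≤ C) :
    (#(s.image fun p => P.history p.1 p.2 t) : ℝ) ≤ 4 ^ C := by
  have h := sum_quarter_pow_historyBits_le_one (P := P) s t
  have h2 : ∑ _h ∈ s.image (fun p => P.history p.1 p.2 t), (1 / 4 : ℝ) ^ C ≤ 1 := by
    refine (sum_le_sum fun h hh => ?_).trans h
    obtain ⟨p, hp, rfl⟩ := mem_image.1 hh
    exact pow_le_pow_of_le_one (by norm_num) (by norm_num) (hC p hp)
  rw [sum_const, nsmul_eq_mul, one_div, inv_pow, ← div_eq_mul_inv, div_le_one (by positivity)]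
    at h2
  exact h2

/-- There is no a priori round bound, but on finitely many inputs all halting runs have halted by a
common time; the histories at that time decide all outputs. -/
theorem exists_time_of_finset (s : Finset (X × Y)) :
    ∃ t, ∀ p ∈ s, ∀ o, P.Outputs p.1 p.2 o → P.coordinator (P.history p.1 p.2 t) = .halt o := by
  have : ∀ p ∈ s, ∀ᶠ t in Filter.atTop, ∀ o, P.Outputs p.1 p.2 o →
      P.coordinator (P.history p.1 p.2 t) = .halt o := by
    intro p _
    by_cases hp : ∃ t o, P.coordinator (P.history p.1 p.2 t) = .halt o
    · obtain ⟨t, o, ho⟩ := hp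
      filter_upwards [Filter.eventually_ge_atTop t] with t' ht' o' ⟨u, hu⟩
      have h1 := history_eq_of_halt ho ht'
      rw [h1, ho]
      have h2 := history_eq_of_halt ho (le_max_left t u)
      have h3 := history_eq_of_halt hu (le_max_right t u)
      rw [← ho, ← hu, ← h2, ← h3]
    · exact Filter.Eventually.of_forall fun t o ⟨u, hu⟩ => absurd ⟨u, o, hu⟩ hp
  exact ((Filter.eventually_all_finset s).2 this).exists

/-- A protocol with `C` bits of communication outputs correctly on at most `4 ^ C` inputs with
pairwise different answers. -/
theorem card_correct_le (s : Finset (X × Y)) (C : ℕ)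
    (hC : ∀ p ∈ s, ∀ t, P.bits p.1 p.2 t ≤ C) (ans : X × Y → O) (hans : Set.InjOn ans s)
    (hs : ∀ p ∈ s, P.Outputs p.1 p.2 (ans p)) : (#s : ℝ) ≤ 4 ^ C := by
  obtain ⟨t, ht⟩ := P.exists_time_of_finset s
  refine le_trans ?_ (card_histories_le (P := P) s t C fun p hp => hC p hp t)
  rw [card_image_of_injOn]
  intro p hp q hq h
  have h1 := ht p hp _ (hs p hp)
  have h2 := ht q hq _ (hs q hq)
  simp only at h
  rw [h, h2] at h1
  exact hans hp hq (by injection h1 with h1; exact h1.symm)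

end CoordinatorProtocol

/-! ### Randomized protocols: cost and counting -/

theorem bits_le_of_communicationCost_le {X Y O Ω : Type*} {P : Ω → CoordinatorProtocol X Y O}
    {Adm : X → Y → Prop} {C : ℕ} (h : communicationCost P Adm ≤ C) (ω : Ω) {x : X} {y : Y}
    (hxy : Adm x y) (t : ℕ) : (P ω).bits x y t ≤ C := by
  have h1 : ((P ω).bits x y t : ℕ∞) ≤ communicationCost P Adm :=
    le_iSup_of_le ω (le_iSup_of_le x (le_iSup_of_le y (le_iSup_of_le hxy
      (le_iSup (fun t => ((P ω).bits x y t : ℕ∞)) t))))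
  exact_mod_cast h1.trans h

/-- Counting bound for randomized protocols: the answer cannot take many values. -/
theorem mul_card_le_four_pow {X Y O Ω : Type*} [MeasurableSpace Ω] (μ : Measure Ω)
    [IsProbabilityMeasure μ] (P : Ω → CoordinatorProtocol X Y O) (s : Finset (X × Y)) (C : ℕ)
    (hC : ∀ ω, ∀ p ∈ s, ∀ t, (P ω).bits p.1 p.2 t ≤ C) (ans : X × Y → O)
    (hans : Set.InjOn ans s) (q : ℝ)
    (hmeas : ∀ p ∈ s, MeasurableSet {ω | (P ω).Outputs p.1 p.2 (ans p)})
    (hq : ∀ p ∈ s, q ≤ μ.real {ω | (P ω).Outputs p.1 p.2 (ans p)}) :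
    q * #s ≤ 4 ^ C := by
  classical
  set A : X × Y → Set Ω := fun p => {ω | (P ω).Outputs p.1 p.2 (ans p)} with hA
  have hint : ∀ p ∈ s, Integrable ((A p).indicator (1 : Ω → ℝ)) μ := fun p hp =>
    (integrable_const (1 : ℝ)).indicator (hmeas p hp)
  calc q * #s = ∑ p ∈ s, q := by rw [sum_const, nsmul_eq_mul, mul_comm]
    _ ≤ ∑ p ∈ s, ∫ ω, (A p).indicator (1 : Ω → ℝ) ω ∂μ := by
        refine sum_le_sum fun p hp => ?_
        rw [integral_indicator_one (hmeas p hp)]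
        exact hq p hp
    _ = ∫ ω, ∑ p ∈ s, (A p).indicator (1 : Ω → ℝ) ω ∂μ := (integral_finsetSum _ hint).symm
    _ ≤ ∫ _ω, (4 : ℝ) ^ C ∂μ := by
        refine integral_mono (integrable_finsetSum _ hint) (integrable_const _) fun ω => ?_
        have := CoordinatorProtocol.card_correct_le (P := P ω) {p ∈ s | ω ∈ A p} C
          (fun p hp => hC ω p (mem_filter.1 hp).1) ans
          (hans.mono fun p hp => (mem_filter.1 hp).1) fun p hp => (mem_filter.1 hp).2
        refine le_trans (le_of_eq ?_) this
        simp [Set.indicator_apply]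
    _ = 4 ^ C := by simp

/-! ### Set disjointness -/

section Disjointness

variable {ι : Type*} [Fintype ι] [DecidableEq ι]

/-- The mean of `Φ` over the random pairs of disjoint points given by a random mask. -/
noncomputable def disjointMean (Φ : (ι → Bool) → (ι → Bool) → ℝ) : ℝ :=
  𝔼 p : (ι → Bool) × (ι → Bool) × (ι → Bool),
    Φ (mask p.1 p.2.1) (mask (maskCompl p.1) p.2.2)

/-- The sum over `i` of the mean of `Φ` over the pairs of `disjointMean` with a common element `i`
planted. -/
noncomputable def plantedSum (Φ : (ι → Bool) → (ι → Bool) → ℝ) : ℝ :=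
  ∑ i, 𝔼 p : (ι → Bool) × (ι → Bool) × (ι → Bool),
    Φ (update (mask p.1 p.2.1) i true) (update (mask (maskCompl p.1) p.2.2) i true)

theorem expect_prod_mul {α β γ : Type*} [Fintype α] [Fintype β] [Fintype γ]
    (f : α → β → ℝ) (g : α → γ → ℝ) :
    𝔼 p : α × β × γ, f p.1 p.2.1 * g p.1 p.2.2 = 𝔼 a, (𝔼 b, f a b) * 𝔼 c, g a c := by
  rw [← univ_product_univ, expect_product]
  refine expect_congr rfl fun a _ => ?_
  rw [← univ_product_univ, expect_product, expect_mul_expect]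

theorem disjointMean_mul (φ ψ : (ι → Bool) → ℝ) :
    disjointMean (fun x y => φ x * ψ y) =
      𝔼 D, maskedMean φ D * maskedMean ψ (maskCompl D) :=
  expect_prod_mul (fun D r => φ (mask D r)) fun D s => ψ (mask (maskCompl D) s)

theorem plantedSum_mul (φ ψ : (ι → Bool) → ℝ) :
    plantedSum (fun x y => φ x * ψ y) =
      ∑ i, 𝔼 D, pinnedMean φ i true D * pinnedMean ψ i true (maskCompl D) :=
  sum_congr rfl fun i _ => expect_prod_mul (fun D r => φ (update (mask D r) i true))
    fun D s => ψ (update (mask (maskCompl D) s) i true)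

theorem disjointMean_sum {κ : Type*} (s : Finset κ) (Φ : κ → (ι → Bool) → (ι → Bool) → ℝ) :
    disjointMean (fun x y => ∑ l ∈ s, Φ l x y) = ∑ l ∈ s, disjointMean (Φ l) :=
  expect_sum_comm _ _ _

theorem plantedSum_sum {κ : Type*} (s : Finset κ) (Φ : κ → (ι → Bool) → (ι → Bool) → ℝ) :
    plantedSum (fun x y => ∑ l ∈ s, Φ l x y) = ∑ l ∈ s, plantedSum (Φ l) := by
  simp_rw [plantedSum, expect_sum_comm]
  exact sum_comm

theorem disjointMean_mono {Φ Ψ : (ι → Bool) → (ι → Bool) → ℝ}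
    (h : ∀ x y, (¬∃ j, x j = true ∧ y j = true) → Φ x y ≤ Ψ x y) :
    disjointMean Φ ≤ disjointMean Ψ :=
  expect_le_expect fun _ _ => h _ _ (not_exists_common_of_mask _ _ _)

theorem plantedSum_mono {Φ Ψ : (ι → Bool) → (ι → Bool) → ℝ}
    (h : ∀ x y, (∃ j, x j = true ∧ y j = true) → Φ x y ≤ Ψ x y) :
    plantedSum Φ ≤ plantedSum Ψ :=
  sum_le_sum fun i _ => expect_le_expect fun _ _ => h _ _ (exists_common_of_update _ _ i)

theorem disjointMean_const (a : ℝ) : disjointMean (fun _ _ : ι → Bool => a) = a :=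
  Fintype.expect_const a

theorem plantedSum_const (a : ℝ) :
    plantedSum (fun _ _ : ι → Bool => a) = Fintype.card ι * a := by
  simp [plantedSum]

/-- Corruption bound for a union of fibres of a labelling whose fibres are rectangles. -/
theorem labelling_corruption {H : Type*} [DecidableEq H] (h : (ι → Bool) → (ι → Bool) → H)
    (hrect : ∀ x y x' y', h x y = h x' y' → h x y' = h x y) (A : H → Prop)
    [DecidablePred A] :
    0.98 * (Fintype.card ι : ℝ) * disjointMean (fun x y => if A (h x y) then 1 else 0) -
      4000 * #(univ.image fun p : (ι → Bool) × (ι → Bool) => h p.1 p.2) *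
        exp (-((Fintype.card ι : ℝ) / 400000)) ≤
      plantedSum (fun x y => if A (h x y) then 1 else 0) := by
  classical
  set s := univ.image fun p : (ι → Bool) × (ι → Bool) => h p.1 p.2 with hs
  let φ : H → (ι → Bool) → ℝ := fun l x => if ∃ y, h x y = l then 1 else 0
  let ψ : H → (ι → Bool) → ℝ := fun l y => if ∃ x, h x y = l then 1 else 0
  -- The rectangle property makes the indicator of each fibre the product of the indicators of its
  -- projections.
  have hmul : ∀ l x y, φ l x * ψ l y = if h x y = l then 1 else 0 := by
    intro l x y
    have : h x y = l ↔ (∃ y', h x y' = l) ∧ ∃ x', h x' y = l := by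
      refine ⟨fun e => ⟨⟨y, e⟩, ⟨x, e⟩⟩, ?_⟩
      rintro ⟨⟨y', e1⟩, x', e2⟩
      exact (hrect x y' x' y (e1.trans e2.symm)).trans e1
    simp only [φ, ψ, this]
    by_cases h1 : ∃ y', h x y' = l <;> by_cases h2 : ∃ x', h x' y = l <;> simp [h1, h2]
  have hΦ : (fun x y => if A (h x y) then (1 : ℝ) else 0) =
      fun x y => ∑ l ∈ s with A l, φ l x * ψ l y := by
    funext x y
    have hmem : h x y ∈ s := mem_image.2 ⟨(x, y), mem_univ _, rfl⟩
    simp_rw [hmul]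
    rw [sum_ite_eq]
    simp [hmem]
  rw [hΦ, disjointMean_sum, plantedSum_sum]
  have hφ : ∀ l x, 0 ≤ φ l x ∧ φ l x ≤ 1 := by
    intro l x
    simp only [φ]
    split_ifs <;> norm_num
  have hψ : ∀ l x, 0 ≤ ψ l x ∧ ψ l x ≤ 1 := by
    intro l x
    simp only [ψ]
    split_ifs <;> norm_num
  have hsum : ∑ l ∈ s with A l,
      (0.98 * (Fintype.card ι : ℝ) * disjointMean (fun x y => φ l x * ψ l y) -
        4000 * exp (-((Fintype.card ι : ℝ) / 400000))) ≤
      ∑ l ∈ s with A l, plantedSum (fun x y => φ l x * ψ l y) := by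
    refine sum_le_sum fun l _ => ?_
    rw [disjointMean_mul, plantedSum_mul]
    exact rectangle_corruption (fun x => (hφ l x).1) (fun x => (hφ l x).2)
      (fun x => (hψ l x).1) fun x => (hψ l x).2
  rw [sum_sub_distrib, ← mul_sum, sum_const, nsmul_eq_mul] at hsum
  have hcard : (#{l ∈ s | A l} : ℝ) ≤ #s := by exact_mod_cast card_filter_le _ _
  have := mul_le_mul_of_nonneg_right hcard
    (show 0 ≤ 4000 * exp (-((Fintype.card ι : ℝ) / 400000)) by positivity)
  linarith

variable {Ω : Type*} [MeasurableSpace Ω] (μ : Measure Ω)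

theorem integrable_expect {κ : Type*} [Fintype κ] {f : κ → Ω → ℝ}
    (hf : ∀ k, Integrable (f k) μ) : Integrable (fun ω => 𝔼 k, f k ω) μ := by
  simp_rw [Fintype.expect_eq_sum_div_card]
  exact (integrable_finsetSum _ fun k _ => hf k).div_const _

theorem integral_expect {κ : Type*} [Fintype κ] {f : κ → Ω → ℝ}
    (hf : ∀ k, Integrable (f k) μ) : ∫ ω, 𝔼 k, f k ω ∂μ = 𝔼 k, ∫ ω, f k ω ∂μ := by
  simp_rw [Fintype.expect_eq_sum_div_card]
  rw [integral_div, integral_finsetSum _ fun k _ => hf k]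

theorem integral_disjointMean {f : (ι → Bool) → (ι → Bool) → Ω → ℝ}
    (hf : ∀ x y, Integrable (f x y) μ) :
    ∫ ω, disjointMean (fun x y => f x y ω) ∂μ = disjointMean fun x y => ∫ ω, f x y ω ∂μ :=
  integral_expect μ fun _ => hf _ _

theorem integrable_disjointMean {f : (ι → Bool) → (ι → Bool) → Ω → ℝ}
    (hf : ∀ x y, Integrable (f x y) μ) :
    Integrable (fun ω => disjointMean (fun x y => f x y ω)) μ :=
  integrable_expect μ fun _ => hf _ _

theorem integral_plantedSum {f : (ι → Bool) → (ι → Bool) → Ω → ℝ}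
    (hf : ∀ x y, Integrable (f x y) μ) :
    ∫ ω, plantedSum (fun x y => f x y ω) ∂μ = plantedSum fun x y => ∫ ω, f x y ω ∂μ := by
  simp_rw [plantedSum]
  rw [integral_finsetSum _ fun i _ => integrable_expect μ fun _ => hf _ _]
  exact sum_congr rfl fun i _ => integral_expect μ fun _ => hf _ _

theorem integrable_plantedSum {f : (ι → Bool) → (ι → Bool) → Ω → ℝ}
    (hf : ∀ x y, Integrable (f x y) μ) :
    Integrable (fun ω => plantedSum (fun x y => f x y ω)) μ :=
  integrable_finsetSum _ fun _ _ => integrable_expect μ fun _ => hf _ _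

/-- Communication lower bound for randomized protocols that distinguish disjoint from intersecting
pairs with success probability `0.51`. -/
theorem disjointness_lower_bound [IsProbabilityMeasure μ] {X Y O : Type*}
    (P : Ω → CoordinatorProtocol X Y O) (e : (ι → Bool) → X) (f : (ι → Bool) → Y)
    (ans : (ι → Bool) → (ι → Bool) → O) (meets : O)
    (hans : ∀ x y, ans x y = meets ↔ ∃ j, x j = true ∧ y j = true) (C : ℕ)
    (hC : ∀ ω x y t, (P ω).bits (e x) (f y) t ≤ C)
    (hmeas : ∀ x y, MeasurableSet {ω | (P ω).Outputs (e x) (f y) (ans x y)})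
    (hp : ∀ x y, 0.51 ≤ μ.real {ω | (P ω).Outputs (e x) (f y) (ans x y)}) :
    0.0098 * (Fintype.card ι : ℝ) ≤ 4000 * 4 ^ C * exp (-((Fintype.card ι : ℝ) / 400000)) := by
  classical
  set n : ℝ := (Fintype.card ι : ℝ) with hn
  set S : (ι → Bool) → (ι → Bool) → Set Ω :=
    fun x y => {ω | (P ω).Outputs (e x) (f y) (ans x y)} with hS
  have hint : ∀ x y, Integrable ((S x y).indicator (1 : Ω → ℝ)) μ := fun x y =>
    (integrable_const (1 : ℝ)).indicator (hmeas x y)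
  have hint' : ∀ x y, Integrable (fun ω => 1 - (S x y).indicator (1 : Ω → ℝ) ω) μ := fun x y =>
    (integrable_const (1 : ℝ)).sub (hint x y)
  have hω : ∀ ω, 0.98 * n * disjointMean (fun x y => (S x y).indicator (1 : Ω → ℝ) ω) -
      4000 * 4 ^ C * exp (-(n / 400000)) ≤
      plantedSum (fun x y => 1 - (S x y).indicator (1 : Ω → ℝ) ω) := by
    intro ω
    obtain ⟨t, ht⟩ := (P ω).exists_time_of_finset
      (univ.image fun p : (ι → Bool) × (ι → Bool) => (e p.1, f p.2))
    have ht' : ∀ x y, ω ∈ S x y →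
        (P ω).coordinator ((P ω).history (e x) (f y) t) = .halt (ans x y) := fun x y h =>
      ht (e x, f y) (mem_image.2 ⟨(x, y), mem_univ _, rfl⟩) _ h
    -- The histories answering "disjoint": correct runs on disjoint pairs lie in `A`, correct runs
    -- on meeting pairs do not.
    let A : List (Exchange × Exchange) → Prop :=
      fun h => ∃ o, o ≠ meets ∧ (P ω).coordinator h = .halt o
    have key := labelling_corruption (fun x y => (P ω).history (e x) (f y) t)
      (fun x y x' y' h => CoordinatorProtocol.history_rectangle h) A
    have hcard : (#(univ.image fun p : (ι → Bool) × (ι → Bool) =>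
        (P ω).history (e p.1) (f p.2) t) : ℝ) ≤ 4 ^ C := by
      have := CoordinatorProtocol.card_histories_le (P := P ω)
        (univ.image fun p : (ι → Bool) × (ι → Bool) => (e p.1, f p.2)) t C (by
          intro p hp
          obtain ⟨q, _, rfl⟩ := mem_image.1 hp
          exact hC ω q.1 q.2 t)
      rw [image_image] at this
      exact this
    have h1 : disjointMean (fun x y => (S x y).indicator (1 : Ω → ℝ) ω) ≤
        disjointMean (fun x y => if A ((P ω).history (e x) (f y) t) then (1 : ℝ) else 0) := by
      refine disjointMean_mono fun x y hxy => ?_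
      by_cases hc : ω ∈ S x y
      · rw [if_pos ⟨ans x y, fun h => hxy ((hans x y).1 h), ht' x y hc⟩]
        simp [hc]
      · rw [Set.indicator_of_notMem hc]
        split_ifs <;> norm_num
    have h2 : plantedSum (fun x y => if A ((P ω).history (e x) (f y) t) then (1 : ℝ) else 0) ≤
        plantedSum (fun x y => 1 - (S x y).indicator (1 : Ω → ℝ) ω) := by
      refine plantedSum_mono fun x y hxy => ?_
      by_cases hc : ω ∈ S x y
      · rw [if_neg]
        · simp [hc]
        · rintro ⟨o, ho, ho'⟩
          rw [ht' x y hc] at ho'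
          injection ho' with ho'
          exact ho (ho'.symm.trans ((hans x y).2 hxy))
      · rw [Set.indicator_of_notMem hc]
        split_ifs <;> norm_num
    have h3 := mul_le_mul_of_nonneg_left h1 (show 0 ≤ 0.98 * n by positivity)
    have h4 := mul_le_mul_of_nonneg_right hcard
      (show 0 ≤ 4000 * exp (-(n / 400000)) by positivity)
    rw [← hn] at key
    linarith
  have hI := integral_mono (((integrable_disjointMean μ hint).const_mul (0.98 * n)).sub
    (integrable_const (4000 * 4 ^ C * exp (-(n / 400000))))) (integrable_plantedSum μ hint') hω
  simp only [Pi.sub_apply] at hI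
  rw [integral_sub ((integrable_disjointMean μ hint).const_mul _) (integrable_const _),
    integral_const_mul, integral_disjointMean μ hint, integral_plantedSum μ hint',
    integral_const, probReal_univ, one_smul] at hI
  have h1 : 0.51 ≤ disjointMean fun x y => ∫ ω, (S x y).indicator (1 : Ω → ℝ) ω ∂μ := by
    rw [← disjointMean_const (ι := ι) 0.51]
    refine disjointMean_mono fun x y _ => ?_
    rw [integral_indicator_one (hmeas x y)]
    exact hp x y
  have h2 : (plantedSum fun x y => ∫ ω, (1 - (S x y).indicator (1 : Ω → ℝ) ω) ∂μ) ≤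
      n * 0.49 := by
    rw [hn, ← plantedSum_const (ι := ι) 0.49]
    refine plantedSum_mono fun x y _ => ?_
    rw [integral_sub (integrable_const _) (hint x y), integral_indicator_one (hmeas x y),
      integral_const, probReal_univ, one_smul]
    have := hp x y
    linarith
  -- The surviving gap is `0.98 * 0.51 - 0.49 = 0.0098`.
  have h3 := mul_le_mul_of_nonneg_left h1 (show 0 ≤ 0.98 * n by positivity)
  linarith

end Disjointness

/-! ### Skylines -/

theorem mem_skyline {S : Finset (ℝ × ℝ)} {u : ℝ × ℝ} :
    u ∈ skyline S ↔ u ∈ S ∧ ∀ v ∈ S, Dominates v u → v = u := by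
  simp [skyline]

theorem mem_joinedPoints {n : ℕ} {T : Set ℝ} {x y : Fin n → T} {u : ℝ × ℝ} :
    u ∈ joinedPoints x y ↔ ∃ i, ((x i : ℝ), (y i : ℝ)) = u := by
  simp [joinedPoints]

theorem skyline_eq_singleton_iff_exists_common {n : ℕ} {T : Set ℝ} {a b : T} (hab : a < b)
    (x y : Fin n → Bool) :
    skyline (joinedPoints (fun i => if x i then b else a) (fun i => if y i then b else a)) =
      {((b : ℝ), (b : ℝ))} ↔ ∃ j, x j = true ∧ y j = true := by
  have hab' : (a : ℝ) < b := hab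
  have hcoe : ∀ c : Bool, ((if c then b else a : T) : ℝ) ≤ b := by
    intro c; cases c <;> simp [hab'.le]
  have hb : ∀ c : Bool, ((if c then b else a : T) : ℝ) = b → c = true := by
    intro c; cases c <;> simp [hab'.ne]
  constructor
  · intro h
    have hm : ((b : ℝ), (b : ℝ)) ∈ skyline
        (joinedPoints (fun i => if x i then b else a) (fun i => if y i then b else a)) := by
      rw [h]; exact mem_singleton_self _
    obtain ⟨j, hj⟩ := mem_joinedPoints.1 (mem_skyline.1 hm).1
    rw [Prod.mk.injEq] at hj
    exact ⟨j, hb _ hj.1, hb _ hj.2⟩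
  · rintro ⟨j, hx, hy⟩
    have hS : ((b : ℝ), (b : ℝ)) ∈
        joinedPoints (fun i => if x i then b else a) (fun i => if y i then b else a) :=
      mem_joinedPoints.2 ⟨j, by simp [hx, hy]⟩
    have hdom : ∀ v ∈ joinedPoints (fun i => if x i then b else a)
        (fun i => if y i then b else a), v.1 ≤ b ∧ v.2 ≤ b := by
      intro v hv
      obtain ⟨i, rfl⟩ := mem_joinedPoints.1 hv
      exact ⟨hcoe _, hcoe _⟩
    ext u
    rw [mem_singleton, mem_skyline]
    constructor
    · rintro ⟨hu, hmax⟩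
      exact (hmax _ hS (hdom u hu)).symm
    · rintro rfl
      exact ⟨hS, fun v hv hd => Prod.ext (le_antisymm (hdom v hv).1 hd.1)
        (le_antisymm (hdom v hv).2 hd.2)⟩

/-- The exponential is at most `exp (-15) ^ C`, and `4 * exp (-15)` is so small that even `C = 1`
beats the factor 4000. -/
theorem four_pow_mul_exp_lt {C : ℕ} (hC : 1 ≤ C) {n : ℝ} (h : 6000000 * (C : ℝ) ≤ n) :
    4000 * 4 ^ C * exp (-(n / 400000)) < 0.0098 := by
  have he : (1640000 : ℝ) ≤ exp 15 := by
    have h1 : exp 15 = exp 1 ^ 15 := by rw [← exp_nat_mul]; norm_num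
    rw [h1]
    calc (1640000 : ℝ) ≤ 2.7 ^ 15 := by norm_num
      _ ≤ exp 1 ^ 15 := by
        gcongr
        linarith [exp_one_gt_d9]
  have h1 : exp (-(n / 400000)) ≤ exp (-15) ^ C := by
    rw [← exp_nat_mul]
    refine exp_le_exp.2 ?_
    linarith
  have h2 : 4 * exp (-15) ≤ 4 / 1640000 := by
    rw [exp_neg, div_eq_mul_inv]
    gcongr
  have h3 : (4 : ℝ) ^ C * exp (-15) ^ C ≤ 4 / 1640000 := by
    rw [← mul_pow]
    exact (pow_le_of_le_one (by positivity) (h2.trans (by norm_num)) (by omega)).trans h2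
  calc 4000 * 4 ^ C * exp (-(n / 400000)) ≤ 4000 * 4 ^ C * exp (-15) ^ C := by gcongr
    _ = 4000 * ((4 : ℝ) ^ C * exp (-15) ^ C) := by ring
    _ ≤ 4000 * (4 / 1640000) := by gcongr
    _ < 0.0098 := by norm_num

/-! ### The two lower bounds -/

theorem card_le_of_computesSkyline_anyPoints {n : ℕ} {T : Set ℝ} {Ω : Type*} [MeasurableSpace Ω]
    {μ : Measure Ω} [IsProbabilityMeasure μ] {P : Ω → VerticalProtocol n T} (hT : T.Nontrivial)
    (hP : ComputesSkyline μ P AnyPoints 0.51) {C : ℕ}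
    (hC : communicationCost P AnyPoints ≤ C) : (n : ℝ) ≤ 6000000 * C := by
  rcases Nat.eq_zero_or_pos n with rfl | hn
  · simp
  obtain ⟨a', ha', b', hb', hab'⟩ := hT.exists_lt
  obtain ⟨a, b, hab⟩ : ∃ a b : T, a < b := ⟨⟨a', ha'⟩, ⟨b', hb'⟩, hab'⟩
  set e : (Fin n → Bool) → Fin n → T := fun x i => if x i then b else a with he
  have hiff : ∀ x y, skyline (joinedPoints (e x) (e y)) = {((b : ℝ), (b : ℝ))} ↔
      ∃ j, x j = true ∧ y j = true := skyline_eq_singleton_iff_exists_common hab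
  -- For `C = 0` and small `n` the disjointness bound says nothing. Instead, two inputs with
  -- different answers would each be answered correctly with probability 0.51, although without
  -- communication only one answer is possible per coin outcome.
  rcases Nat.eq_zero_or_pos C with rfl | hC1
  · exfalso
    classical
    have hne : skyline (joinedPoints (e fun _ => true) (e fun _ => true)) ≠
        skyline (joinedPoints (e fun _ => false) (e fun _ => false)) := by
      rw [(hiff _ _).2 ⟨⟨0, hn⟩, rfl, rfl⟩]
      intro h
      obtain ⟨j, hj, _⟩ := (hiff _ _).1 h.symm
      cases hj
    have h := mul_card_le_four_pow μ P
      {(e fun _ => true, e fun _ => true), (e fun _ => false, e fun _ => false)} 0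
      (fun ω p _ t => bits_le_of_communicationCost_le hC ω trivial t)
      (fun p => skyline (joinedPoints p.1 p.2)) (by
        intro p hp q hq hpq
        simp only [coe_insert, coe_singleton, Set.mem_insert_iff, Set.mem_singleton_iff] at hp hq
        rcases hp with rfl | rfl <;> rcases hq with rfl | rfl
        · rfl
        · exact absurd hpq hne
        · exact absurd hpq.symm hne
        · rfl) 0.51 (fun p _ => (hP p.1 p.2 trivial).1) fun p _ => (hP p.1 p.2 trivial).2
    rw [card_pair (fun h => hne (by rw [(Prod.mk.inj h).1]))] at h
    norm_num at h
  · by_contra! hlt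
    have h := disjointness_lower_bound μ P e e (fun x y => skyline (joinedPoints (e x) (e y)))
      _ hiff C (fun ω x y t => bits_le_of_communicationCost_le hC ω trivial t)
      (fun x y => (hP _ _ trivial).1) fun x y => (hP _ _ trivial).2
    rw [Fintype.card_fin] at h
    have h2 := four_pow_mul_exp_lt hC1 hlt.le
    have h3 : (1 : ℝ) ≤ n := by exact_mod_cast hn
    linarith

theorem skyline_eq_self {S : Finset (ℝ × ℝ)} (h : ∀ u ∈ S, ∀ v ∈ S, Dominates v u → v = u) :
    skyline S = S := by
  ext u
  rw [mem_skyline]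
  exact ⟨fun hu => hu.1, fun hu => ⟨hu, h u hu⟩⟩

theorem card_le_of_computesSkyline_distinctPoints {n : ℕ} {T : Set ℝ} {Ω : Type*}
    [MeasurableSpace Ω] {μ : Measure Ω} [IsProbabilityMeasure μ] {P : Ω → VerticalProtocol n T}
    (hT : (2 * n : ℕ∞) ≤ T.encard) (hP : ComputesSkyline μ P DistinctPoints 0.51) {C : ℕ}
    (hC : communicationCost P DistinctPoints ≤ C) : n ≤ 2 * C := by
  classical
  obtain ⟨T', hT', hcard⟩ := Set.exists_subset_encard_eq hT
  have hfin : T'.Finite := Set.finite_of_encard_eq_coe (k := 2 * n) (by simpa using hcard)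
  have hcard' : #hfin.toFinset = 2 * n := by
    rw [hfin.encard_eq_coe_toFinset_card] at hcard
    exact_mod_cast hcard
  set τ := hfin.toFinset.orderEmbOfFin hcard' with hτ
  have hτT : ∀ k, τ k ∈ T := fun k =>
    hT' (hfin.mem_toFinset.1 (orderEmbOfFin_mem hfin.toFinset hcard' k))
  -- A descending staircase: bit `r i` chooses between the adjacent values `τ (2i)` and `τ (2i +
  -- 1)`, which keeps the order in `i`, while `y` is strictly decreasing. The points form an
  -- antichain, and `y` identifies the ID, so the bits can be read off the skyline.
  let x : (Fin n → Bool) → Fin n → T := fun r i =>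
    ⟨τ ⟨2 * i + (if r i then 1 else 0), by split_ifs <;> omega⟩, hτT _⟩
  let y : Fin n → T := fun i => ⟨τ ⟨2 * (n - 1 - i), by omega⟩, hτT _⟩
  have hx : ∀ r r' i j, ((x r i : T) : ℝ) ≤ x r' j → i ≤ j := by
    intro r r' i j h
    have h' := τ.le_iff_le.1 h
    rw [Fin.mk_le_mk] at h'
    rw [Fin.le_def]
    split_ifs at h' <;> omega
  have hy : ∀ i j, ((y i : T) : ℝ) ≤ y j → j ≤ i := by
    intro i j h
    have h' := τ.le_iff_le.1 h
    rw [Fin.mk_le_mk] at h'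
    rw [Fin.le_def]
    omega
  have hyinj : ∀ i j, ((y i : T) : ℝ) = y j → i = j := fun i j h =>
    le_antisymm (hy _ _ h.ge) (hy _ _ h.le)
  have hadm : ∀ r, DistinctPoints (x r) y := by
    intro r i j h
    exact hyinj i j (congrArg Subtype.val (Prod.mk.inj h).2)
  have hsky : ∀ r, skyline (joinedPoints (x r) y) = joinedPoints (x r) y := by
    intro r
    refine skyline_eq_self fun u hu v hv hd => ?_
    obtain ⟨i, rfl⟩ := mem_joinedPoints.1 hu
    obtain ⟨j, rfl⟩ := mem_joinedPoints.1 hv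
    rw [le_antisymm (hx _ _ _ _ hd.1) (hy _ _ hd.2)]
  have hinj : ∀ r r', joinedPoints (x r) y = joinedPoints (x r') y → r = r' := by
    intro r r' h
    funext i
    have hi : (((x r i : T) : ℝ), ((y i : T) : ℝ)) ∈ joinedPoints (x r') y := by
      rw [← h]; exact mem_joinedPoints.2 ⟨i, rfl⟩
    obtain ⟨j, hj⟩ := mem_joinedPoints.1 hi
    rw [Prod.mk.injEq] at hj
    obtain rfl := hyinj _ _ hj.2
    have := τ.injective hj.1
    rw [Fin.mk.injEq] at this
    cases hr : r j <;> cases hr' : r' j <;> simp_all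
  have hxinj : Injective fun r => (x r, y) := fun r r' h => hinj r r' (by
    rw [(Prod.mk.inj h).1])
  have h := mul_card_le_four_pow μ P (univ.image fun r => (x r, y)) C
    (by
      intro ω p hp t
      obtain ⟨r, _, rfl⟩ := mem_image.1 hp
      exact bits_le_of_communicationCost_le hC ω (hadm r) t)
    (fun p => skyline (joinedPoints p.1 p.2))
    (by
      intro p hp q hq hpq
      obtain ⟨r, _, rfl⟩ := mem_image.1 hp
      obtain ⟨r', _, rfl⟩ := mem_image.1 hq
      simp only [hsky] at hpq
      rw [hinj r r' hpq]) 0.51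
    (by
      intro p hp
      obtain ⟨r, _, rfl⟩ := mem_image.1 hp
      exact (hP _ _ (hadm r)).1)
    (by
      intro p hp
      obtain ⟨r, _, rfl⟩ := mem_image.1 hp
      exact (hP _ _ (hadm r)).2)
  rw [card_image_of_injective _ hxinj, card_univ] at h
  simp only [Fintype.card_fun, Fintype.card_bool, Fintype.card_fin, Nat.cast_pow,
    Nat.cast_ofNat] at h
  -- If `2 * C < n`, then `2 ^ n ≥ 2 * 4 ^ C`, contradicting `0.51 * 2 ^ n ≤ 4 ^ C` since `0.51 * 2
  -- > 1`.
  by_contra! hlt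
  have h2 : (2 : ℝ) * 4 ^ C ≤ 2 ^ n := by
    rw [show (4 : ℝ) = 2 ^ 2 by norm_num, ← pow_mul, ← pow_succ']
    exact pow_le_pow_right₀ (by norm_num) hlt
  have h3 : (0 : ℝ) < 4 ^ C := by positivity
  linarith

theorem mul_le_coe_of_forall_nat {n : ℕ} {κ : ℕ∞}
    (h : ∀ C : ℕ, κ ≤ C → (n : ℝ) ≤ 6000000 * C) :
    (((1 / 6000000 : ℝ≥0)) : ℝ≥0∞) * (n : ℝ≥0∞) ≤ (κ : ℝ≥0∞) := by
  cases κ with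
  | top => simp
  | coe C =>
    have hC := h C le_rfl
    have : (1 / 6000000 : ℝ≥0) * (n : ℝ≥0) ≤ (C : ℝ≥0) := by
      rw [← NNReal.coe_le_coe]
      push_cast
      linarith
    rw [ENat.toENNReal_coe]
    exact_mod_cast this

theorem mainTheorem5 :
    ∃ c : ℝ≥0, 0 < c ∧
      ∀ (n : ℕ) (T : Set ℝ) (Ω : Type*) [MeasurableSpace Ω] (μ : Measure Ω)
        [IsProbabilityMeasure μ] (P : Ω → VerticalProtocol n T),
        (T.Nontrivial → ComputesSkyline μ P AnyPoints 0.51 →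
          (c : ℝ≥0∞) * (n : ℝ≥0∞) ≤ (communicationCost P AnyPoints : ℝ≥0∞)) ∧
        ((2 * n : ℕ∞) ≤ T.encard → ComputesSkyline μ P DistinctPoints 0.51 →
          (c : ℝ≥0∞) * (n : ℝ≥0∞) ≤ (communicationCost P DistinctPoints : ℝ≥0∞)) := by
  refine ⟨1 / 6000000, by positivity, fun n T Ω _ μ _ P => ⟨fun hT hP => ?_, fun hT hP => ?_⟩⟩
  · exact mul_le_coe_of_forall_nat fun C hC => card_le_of_computesSkyline_anyPoints hT hP hC
  · refine mul_le_coe_of_forall_nat fun C hC => ?_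
    have h : (n : ℝ) ≤ 2 * C := by
      exact_mod_cast card_le_of_computesSkyline_distinctPoints hT hP hC
    have hC0 : (0 : ℝ) ≤ C := C.cast_nonneg
    linarith
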